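/- Graphs are finite connected multigraphs without loops. For such a graph $G$ with adjacency matrix $A$ (entries: numbers of edges) and degree matrix $D$, let $L=A-D$; the critical group $K(G)$ is the group of integer functions on the vertices with total sum zero modulo the integral combinations of the columns of $L$; it is a finite abelian group. For a group $\Gamma$ of automorphisms of $G$ (permutations of vertices and edges compatible with incidence), $G/\Gamma$ is the multigraph whose vertices are the $\Gamma$-orbits of vertices of $G$ and whose edges are the $\Gamma$-orbits of those edges of $G$ whose endpoints lie in different vertex orbits. The group $\Gamma$ acts harmonically if for every subgroup $\Delta\le\Gamma$ the quotient map $G\to G/\Delta$ is harmonic, i.e. for each vertex $x$ of $G$ the number of edges at $x$ lying over an edge $e'$ of $G/\Delta$ at the image of $x$ is the same for all such $e'$. Let $\sigma_1,\sigma_2$ be automorphisms of order two of $G$ such that the group they generate is isomorphic to the dihedral group $D_n$ of order $2n$, acts harmonically on $G$, and has the property that each of its orbits on the vertices of $G$ has either $n$ or $2n$ points. Then the groups $K(G)$, $K(G/D_n)$, $K(G/\sigma_1)$, $K(G/\sigma_2)$, $K(G/\sigma_1\sigma_2)$ are finite and $$|K(G)|\cdot|K(G/D_n)|^2 = n\cdot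 |K(G/\sigma_1)|\cdot|K(G/\sigma_2)|\cdot|K(G/\sigma_1\sigma_2)| .$$ -/

import Mathlib

/-- A loopless multigraph with vertex type `V` and edge type `E`: every edge `e` has an unordered
pair `ends e` of distinct endpoints.  Parallel edges are allowed. -/
structure Multigraph (V E : Type*) where
  ends : E → Sym2 V
  loopless : ∀ e, ¬ (ends e).IsDiag

namespace Multigraph

section Basic

variable {V E : Type*} (G : Multigraph V E)

/-- The simple graph recording which pairs of vertices are joined by at least one edge. -/
def toSimpleGraph : SimpleGraph V where
  Adj u v := ∃ e, G.ends e = s(u, v)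
  symm := ⟨fun u v ⟨e, he⟩ => ⟨e, by rw [he, Sym2.eq_swap]⟩⟩
  loopless := ⟨fun u ⟨e, he⟩ => G.loopless e (by simp [he])⟩

/-- `G` is connected (in particular it has a vertex). -/
def Connected : Prop := G.toSimpleGraph.Connected

/-- The number of edges joining `u` and `v`, as an integer matrix. -/
noncomputable def adjMatrix : Matrix V V ℤ :=
  Matrix.of fun u v => (Nat.card {e : E // G.ends e = s(u, v)} : ℤ)

open Classical in
/-- The diagonal matrix of the vertex degrees (numbers of incident edges). -/
noncomputable def degMatrix : Matrix V V ℤ :=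
  Matrix.diagonal fun v => (Nat.card {e : E // v ∈ G.ends e} : ℤ)

/-- The Laplacian matrix `L = A - D`. -/
noncomputable def laplacian : Matrix V V ℤ := G.adjMatrix - G.degMatrix

/-- The divisors (integer valued functions on the finite vertex set) of total degree zero. -/
def degreeZero (V : Type*) [Finite V] : AddSubgroup (V → ℤ) where
  carrier := {δ | ∑ᶠ v, δ v = 0}
  zero_mem' := by simp
  add_mem' {a b} ha hb := by
    simp only [Set.mem_ofPred_eq, Pi.add_apply] at *
    rw [finsum_add_distrib (Set.toFinite _) (Set.toFinite _), ha, hb, add_zero]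
  neg_mem' {a} ha := by
    simp only [Set.mem_ofPred_eq, Pi.neg_apply] at *
    rw [finsum_neg_distrib, ha, neg_zero]

/-- The integral combinations of the columns of the Laplacian. -/
def principal : AddSubgroup (V → ℤ) :=
  AddSubgroup.closure (Set.range fun v : V => fun u : V => G.laplacian u v)

/-- The critical group (Jacobian) `K(G)`: divisors of degree zero modulo integral combinations of
the columns of the Laplacian. -/
abbrev CriticalGroup [Finite V] : Type _ :=
  degreeZero V ⧸ G.principal.addSubgroupOf (degreeZero V)

/-- The automorphism group of `G`: pairs of a permutation of the vertices and a permutation of the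
edges that are compatible with taking endpoints. -/
def Aut : Subgroup (Equiv.Perm V × Equiv.Perm E) where
  carrier := {p | ∀ e, G.ends (p.2 e) = (G.ends e).map p.1}
  one_mem' e := by simp
  mul_mem' {p q} hp hq e := by
    have h1 := hp (q.2 e)
    have h2 := hq e
    simp only [Prod.snd_mul, Prod.fst_mul, Equiv.Perm.coe_mul, Function.comp_apply]
    rw [h1, h2, Sym2.map_map]
    rfl
  inv_mem' {p} hp e := by
    have h := hp (p.2⁻¹ e)
    have h2 : p.2 (p.2⁻¹ e) = e := p.2.apply_symm_apply e
    have h1 : (p.1⁻¹ : Equiv.Perm V) ∘ p.1 = id := funext p.1.symm_apply_apply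
    rw [h2] at h
    change G.ends (p.2⁻¹ e) = (G.ends e).map (p.1⁻¹ : Equiv.Perm V)
    rw [h, Sym2.map_map, h1, Sym2.map_id, id]

instance : MulAction G.Aut V where
  smul g v := g.1.1 v
  one_smul _ := rfl
  mul_smul _ _ _ := rfl

instance : MulAction G.Aut E where
  smul g e := g.1.2 e
  one_smul _ := rfl
  mul_smul _ _ _ := rfl

theorem ends_smul (g : G.Aut) (e : E) : G.ends (g • e) = (G.ends e).map (g • ·) := g.2 e

end Basic

/-- A morphism of multigraphs.  Every edge is either mapped to an edge joining the images of its
endpoints (`some`), or its endpoints have the same image and it is contracted to that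
vertex (`none`). -/
structure Morphism {V E V' E' : Type*} (G : Multigraph V E) (G' : Multigraph V' E') where
  onVert : V → V'
  onEdge : E → Option E'
  map_edge : ∀ e e', onEdge e = some e' → G'.ends e' = (G.ends e).map onVert
  contract_edge : ∀ e, onEdge e = none → ((G.ends e).map onVert).IsDiag

/-- A morphism is harmonic if at every vertex `x` the number of edges at `x` lying over an edge `e'`
at the image of `x` does not depend on the choice of `e'`. -/
def Morphism.IsHarmonic {V E V' E' : Type*} {G : Multigraph V E} {G' : Multigraph V' E'}
    (φ : Morphism G G') : Prop :=
  ∀ (x : V) (e₁ e₂ : E'), φ.onVert x ∈ G'.ends e₁ → φ.onVert x ∈ G'.ends e₂ →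
    Nat.card {e : E // x ∈ G.ends e ∧ φ.onEdge e = some e₁} =
      Nat.card {e : E // x ∈ G.ends e ∧ φ.onEdge e = some e₂}

section Quotient

variable {V E : Type*} (G : Multigraph V E) (H : Subgroup G.Aut)

/-- The vertices of `G / H`: the `H`-orbits of vertices. -/
abbrev QuotVert : Type _ := MulAction.orbitRel.Quotient H V

/-- The pair of vertex orbits joined by an orbit of edges. -/
def quotEnds : MulAction.orbitRel.Quotient H E → Sym2 (G.QuotVert H) :=
  Quotient.lift (fun e => (G.ends e).map (Quotient.mk (MulAction.orbitRel H V))) (by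
    rintro a b ⟨h, rfl⟩
    change (G.ends ((h : G.Aut) • b)).map _ = _
    rw [ends_smul, Sym2.map_map]
    congr 1
    funext v
    exact Quotient.sound ⟨h, rfl⟩)

/-- The edges of `G / H`: the `H`-orbits of those edges whose endpoints lie in different
`H`-orbits. -/
abbrev QuotEdge : Type _ :=
  {q : MulAction.orbitRel.Quotient H E // ¬ (G.quotEnds H q).IsDiag}

/-- The quotient graph `G / H`. -/
def quot : Multigraph (G.QuotVert H) (G.QuotEdge H) where
  ends q := G.quotEnds H q.1
  loopless q := q.2

open Classical in
/-- The quotient morphism `G → G / H`. -/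
noncomputable def quotMap : Morphism G (G.quot H) where
  onVert := Quotient.mk (MulAction.orbitRel H V)
  onEdge e :=
    if h : (G.quotEnds H (Quotient.mk (MulAction.orbitRel H E) e)).IsDiag then none
    else some ⟨Quotient.mk (MulAction.orbitRel H E) e, h⟩
  map_edge e e' h := by
    split_ifs at h with h0
    cases h
    rfl
  contract_edge e h := by
    split_ifs at h with h0
    exact h0

/-- The group of automorphisms `H` acts harmonically on `G`: for every subgroup `Δ` of `H` the
quotient morphism `G → G / Δ` is harmonic. -/
def ActsHarmonically : Prop := ∀ Δ : Subgroup G.Aut, Δ ≤ H → (G.quotMap Δ).IsHarmonic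

end Quotient

end Multigraph

/-!
For a subgroup `Δ` of the group `Γ = ⟨σ₁, σ₂⟩` write `m x` for the order of the stabilizer `Δ_x`.

A harmonic action is free on the edges at a vertex (`ActsHarmonically.eq_one_of_smul_eq`), so the
quotient map `φ : G → G / Δ` covers each edge at `φ x` exactly `m x` times at `x`.  Hence the
Laplacian `L` of `G`, restricted to the `Δ`-invariant functions on `V`, is `m` times the Laplacian
of `G / Δ` (`ActsHarmonically.sum_laplacian_mul_mk`).  Adding the all-ones matrix makes `L` an
invertible operator `T` that still commutes with `Γ`.  By a form of the matrix-tree theorem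
(`Connected.card_criticalGroup`, `Connected.abs_det_laplacian_add_vecMulVec`), up to sign
`det (T | Δ-invariants) = (∏ m) * |V| ^ 2 * |K(G / Δ)| / |Δ|`, the product being over the orbits of
`Δ` on `V`.

The spaces of invariants of a representation of `Γ` over `ℚ` satisfy the Brauer relation
`M ⊕ M^Γ ⊕ M^Γ ≅ M^σ₁ ⊕ M^σ₂ ⊕ M^(σ₁σ₂)`, naturally in `M`; an equivariant injection in
each direction proves it without character theory (`LinearMap.det_mul_det_sq_eq_of_involutions`).  Taking
determinants of `T` gives the formula up to the factors `|Δ|`, which produce `n`, and the products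
of stabilizer orders.  The latter cancel: all stabilizers have order one or two, so such a product
is a power of two with exponent `2 * |V / Δ| - 2 * |V| / |Δ|` (`exists_prod_stabCard_eq_two_pow`),
and the numbers of orbits satisfy the additive form of the same relation
(`card_add_two_mul_card_quotVert`).
-/

/-! ### Determinants and the Brauer relation of two involutions -/

namespace LinearMap

variable {K M N : Type*} [Field K] [AddCommGroup M] [Module K M] [AddCommGroup N] [Module K N]

/-- Endomorphisms of finite-dimensional spaces that are intertwined by an injection `i` have the
same determinant if there is any injection `j` in the other direction: comparing dimensions, `i` is
an isomorphism. -/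
theorem det_eq_of_injective_of_injective [FiniteDimensional K M] [FiniteDimensional K N]
    {f : M →ₗ[K] M} {g : N →ₗ[K] N} (i : M →ₗ[K] N) (hi : Function.Injective i)
    (hig : ∀ v, i (f v) = g (i v)) (j : N →ₗ[K] M) (hj : Function.Injective j) :
    LinearMap.det f = LinearMap.det g := by
  have hd : Module.finrank K M = Module.finrank K N :=
    le_antisymm (LinearMap.finrank_le_finrank_of_injective hi)
      (LinearMap.finrank_le_finrank_of_injective hj)
  let e : M ≃ₗ[K] N := LinearEquiv.ofInjectiveOfFinrankEq i hi hd
  rw [← LinearMap.det_conj f e]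
  congr 1
  ext w
  obtain ⟨v, rfl⟩ := e.surjective w
  have he : ∀ v, e v = i v := fun _ => rfl
  have he' : e.symm (i v) = v := e.symm_apply_apply v
  simp [he, hig, he']

/-- A linear map with values in the range of an injection `a` factors through `a`. -/
theorem exists_lift_of_injective {X : Type*} [AddCommGroup X] [Module K X] {a : N →ₗ[K] M}
    (ha : Function.Injective a) (f : X →ₗ[K] M) (hf : ∀ x, f x ∈ range a) :
    ∃ g : X →ₗ[K] N, ∀ x, a (g x) = f x :=
  ⟨(LinearEquiv.ofInjective a ha).symm.toLinearMap ∘ₗ f.codRestrict _ hf, fun x =>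
    congrArg Subtype.val ((LinearEquiv.ofInjective a ha).apply_symm_apply ⟨f x, hf x⟩)⟩

/-- The determinant form of the Brauer relation `1 + 2 · Γ = ⟨s⟩ + ⟨t⟩ + ⟨ts⟩` for the group `Γ`
generated by two involutions `s` and `t`.  The space of invariants of a linear map `g` is the range
of an injection `ι g` with a given endomorphism inducing `T` there; `p` is the averaging projection
onto the invariants of `t * s`. -/
theorem det_mul_det_sq_eq_of_involutions [CharZero K] [FiniteDimensional K M]
    {A B C D : Type*} [AddCommGroup A] [Module K A] [AddCommGroup B] [Module K B]
    [AddCommGroup C] [Module K C] [AddCommGroup D] [Module K D]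
    [FiniteDimensional K A] [FiniteDimensional K B] [FiniteDimensional K C] [FiniteDimensional K D]
    {s t p T : M →ₗ[K] M} (hs : ∀ v, s (s v) = v) (ht : ∀ v, t (t v) = v)
    (hp : ∀ v, t (s v) = v → p v = v) (hrp : ∀ v, t (s (p v)) = p v)
    (hps : ∀ v, p (s v) = s (p v)) (hpt : ∀ v, p (t v) = t (p v)) (hpT : ∀ v, p (T v) = T (p v))
    (hsT : ∀ v, s (T v) = T (s v)) (htT : ∀ v, t (T v) = T (t v))
    {a : A →ₗ[K] M} (ha : Function.Injective a) (ha' : ∀ v, v ∈ range a ↔ s v = v)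
    {TA : A →ₗ[K] A} (haT : ∀ x, a (TA x) = T (a x))
    {b : B →ₗ[K] M} (hb : Function.Injective b) (hb' : ∀ v, v ∈ range b ↔ t v = v)
    {TB : B →ₗ[K] B} (hbT : ∀ x, b (TB x) = T (b x))
    {c : C →ₗ[K] M} (hc : Function.Injective c) (hc' : ∀ v, v ∈ range c ↔ t (s v) = v)
    {TC : C →ₗ[K] C} (hcT : ∀ x, c (TC x) = T (c x))
    {d : D →ₗ[K] M} (hd : Function.Injective d) (hd' : ∀ v, v ∈ range d ↔ s v = v ∧ t v = v)
    {TD : D →ₗ[K] D} (hdT : ∀ x, d (TD x) = T (d x)) :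
    LinearMap.det T * LinearMap.det TD ^ 2 =
      LinearMap.det TA * LinearMap.det TB * LinearMap.det TC := by
  have hpfix : ∀ v, t (s v) = v ↔ p v = v := fun v => ⟨hp v, fun h => by rw [← h, hrp]⟩
  -- projecting an invariant of one involution gives an invariant of both
  have hsp : ∀ x, s x = x → s (p x) = p x ∧ t (p x) = p x := fun x hx => by
    have h1 : s (p x) = p x := by rw [← hps, hx]
    exact ⟨h1, by simpa [h1] using hrp x⟩
  have htp : ∀ x, t x = x → s (p x) = p x ∧ t (p x) = p x := fun x hx => by
    have h1 : t (p x) = p x := by rw [← hpt, hx]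
    refine ⟨?_, h1⟩
    rw [← ht (s (p x)), hrp, h1]
  have sA : ∀ x, s (a x) = a x := fun x => (ha' _).1 ⟨x, rfl⟩
  have tB : ∀ x, t (b x) = b x := fun x => (hb' _).1 ⟨x, rfl⟩
  have pC : ∀ x, p (c x) = c x := fun x => hp _ ((hc' _).1 ⟨x, rfl⟩)
  have sD : ∀ x, s (d x) = d x := fun x => ((hd' _).1 ⟨x, rfl⟩).1
  have tD : ∀ x, t (d x) = d x := fun x => ((hd' _).1 ⟨x, rfl⟩).2
  have pD : ∀ x, p (d x) = d x := fun x => hp _ (by rw [sD, tD])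
  have hz : ∀ v : M, v + v = 0 → v = 0 := fun v hv => by
    rw [← two_smul K, smul_eq_zero] at hv
    exact hv.resolve_left two_ne_zero
  have hpp : ∀ v, p (p v) = p v := fun v => hp _ (hrp v)
  obtain ⟨f₁, hf₁⟩ := exists_lift_of_injective ha (LinearMap.id + s)
    fun x => (ha' _).2 (by simp [hs, add_comm])
  obtain ⟨f₂, hf₂⟩ := exists_lift_of_injective hb ((LinearMap.id + t) ∘ₗ (LinearMap.id - s))
    fun x => (hb' _).2 (by simp [ht]; abel)
  obtain ⟨f₃, hf₃⟩ := exists_lift_of_injective hc p fun x => (hc' _).2 (hrp x)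
  obtain ⟨dA, hdA⟩ := exists_lift_of_injective ha d fun x => (ha' _).2 (sD x)
  obtain ⟨dB, hdB⟩ := exists_lift_of_injective hb d fun x => (hb' _).2 (tD x)
  obtain ⟨g₁, hg₁⟩ := exists_lift_of_injective hd (p ∘ₗ a) fun x => (hd' _).2 (hsp _ (sA x))
  obtain ⟨g₂, hg₂⟩ := exists_lift_of_injective hd (p ∘ₗ b) fun x => (hd' _).2 (htp _ (tB x))
  simp only [LinearMap.add_apply, LinearMap.sub_apply, LinearMap.id_apply,
    LinearMap.comp_apply] at hf₁ hf₂ hg₁ hg₂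
  -- `(v, x, y) ↦ ((1 + s) v + x, (1 + t) (1 - s) v + y, p v)`
  let Φ : M × D × D →ₗ[K] A × B × C :=
    LinearMap.prod (f₁.coprod (dA ∘ₗ LinearMap.fst K D D))
      (LinearMap.prod (f₂.coprod (dB ∘ₗ LinearMap.snd K D D)) (f₃ ∘ₗ LinearMap.fst K M (D × D)))
  -- `(x, y, z) ↦ (x + (1 - s) y + z, p x, p y)`
  let Ψ : A × B × C →ₗ[K] M × D × D :=
    LinearMap.prod (a.coprod (((LinearMap.id - s) ∘ₗ b).coprod c))
      (LinearMap.prod (g₁ ∘ₗ LinearMap.fst K A (B × C))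
        (g₂ ∘ₗ LinearMap.fst K B C ∘ₗ LinearMap.snd K A (B × C)))
  have hΦ' : ∀ v x y, Φ (v, x, y) = (f₁ v + dA x, f₂ v + dB y, f₃ v) := fun _ _ _ => rfl
  have hΨ' : ∀ x y z, Ψ (x, y, z) = (a x + ((b y - s (b y)) + c z), g₁ x, g₂ y) :=
    fun _ _ _ => rfl
  have hΦ : Function.Injective Φ := by
    rw [injective_iff_map_eq_zero]
    rintro ⟨v, x, y⟩ h
    simp only [hΦ', Prod.mk_eq_zero] at h
    obtain ⟨h1, h2, h3⟩ := h
    have h3' := congrArg c h3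
    have h1' := congrArg a h1
    have h2' := congrArg b h2
    simp only [map_add, hf₁, hf₂, hf₃, hdA, hdB, map_zero] at h1' h2' h3'
    have hx : d x = 0 := by simpa [hps, h3', pD] using congrArg p h1'
    have hy : d y = 0 := by simpa [hps, hpt, h3', pD] using congrArg p h2'
    rw [hx, add_zero] at h1'
    rw [hy, add_zero] at h2'
    have hsv : s v = -v := (neg_eq_of_add_eq_zero_right h1').symm
    have h4 : v + t v = 0 := hz _ (by
      rw [← h2', hsv, map_sub, map_neg]; abel)
    have htv : t v = -v := (neg_eq_of_add_eq_zero_right h4).symm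
    have hv : v = 0 := by
      rw [← h3']
      exact (hp v (by rw [hsv, map_neg, htv, neg_neg])).symm
    rw [← map_zero d] at hx hy
    rw [hv, hd hx, hd hy]
    rfl
  have hΨ : Function.Injective Ψ := by
    rw [injective_iff_map_eq_zero]
    rintro ⟨x, y, z⟩ h
    simp only [hΨ', Prod.mk_eq_zero] at h
    obtain ⟨h1, h2, h3⟩ := h
    have h2' := congrArg d h2
    have h3' := congrArg d h3
    rw [hg₁, map_zero] at h2'
    rw [hg₂, map_zero] at h3'
    have hcz : c z = 0 := by simpa [hps, pC, h2', h3'] using congrArg p h1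
    rw [hcz, add_zero] at h1
    have hax : a x = 0 := hz _ (by
      have h4 := congrArg s h1
      rw [map_add, map_sub, hs, sA, map_zero] at h4
      have h5 : a x + a x = (a x + (b y - s (b y))) + (a x + (s (b y) - b y)) := by abel
      rw [h5, h1, h4, add_zero])
    rw [hax, zero_add, sub_eq_zero] at h1
    have hby : b y = 0 := by
      rw [← h3']
      exact (hp _ (by rw [← h1, tB])).symm
    rw [← map_zero a] at hax
    rw [← map_zero b] at hby
    rw [← map_zero c] at hcz
    rw [ha hax, hb hby, hc hcz]
    rfl
  have key := det_eq_of_injective_of_injective (f := T.prodMap (TD.prodMap TD))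
    (g := TA.prodMap (TB.prodMap TC)) Φ hΦ ?_ Ψ hΨ
  · rw [LinearMap.det_prodMap, LinearMap.det_prodMap, LinearMap.det_prodMap,
      LinearMap.det_prodMap] at key
    rw [pow_two, key, mul_assoc]
  · rintro ⟨v, x, y⟩
    simp only [hΦ', LinearMap.prodMap_apply, Prod.mk.injEq]
    refine ⟨ha ?_, hb ?_, hc ?_⟩
    · simp only [map_add, hf₁, hdA, haT, hdT, hsT]
    · simp only [map_add, map_sub, hf₂, hdB, hbT, hdT, hsT, htT]
    · simp only [hf₃, hcT, hpT]

end LinearMap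

/-! ### Rank one perturbations and indices of integer matrices -/

namespace Matrix

variable {n R : Type*} [Fintype n] [DecidableEq n] [CommRing R]

/-- If all row and column sums of `L` vanish, the determinant of a rank one perturbation of `L` is,
up to the coordinate sums of the two vectors, independent of the perturbation: adding multiples of
the all-ones vector to rows and columns moves one into the other. -/
theorem det_add_vecMulVec_of_sum_eq_zero (L : Matrix n n R) (hr : L *ᵥ 1 = 0) (hc : 1 ᵥ* L = 0)
    (u w : n → R) (i : n) :
    (L + vecMulVec u w).det =
      (∑ j, u j) * (∑ j, w j) * (L + vecMulVec (Pi.single i 1) (Pi.single i 1)).det := by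
  have h : L + vecMulVec u w =
      (1 + vecMulVec (u - Pi.single i 1) 1) * (L + vecMulVec (Pi.single i 1) (Pi.single i 1)) *
        (1 + vecMulVec 1 (w - Pi.single i 1)) := by
    have h1 : ∀ v, vecMulVec v 1 * L = 0 := fun v => by rw [vecMulVec_mul, hc, vecMulVec_zero]
    have h2 : ∀ v, L * vecMulVec 1 v = 0 := fun v => by rw [mul_vecMulVec, hr, zero_vecMulVec]
    simp only [add_mul, mul_add, one_mul, mul_one, h1, h2, vecMulVec_mul_vecMulVec, zero_mul]
    ext a b
    simp [vecMulVec_apply]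
    ring
  have hdet : ∀ x y : n → R, (1 + vecMulVec x y).det = 1 + y ⬝ᵥ x := by
    intro x y
    rw [vecMulVec_eq Unit, det_one_add_replicateCol_mul_replicateRow]
  rw [h, det_mul, det_mul, hdet, hdet]
  simp [dotProduct]
  ring

/-- The index of the image of a nonsingular integer matrix is the absolute value of its
determinant. -/
theorem index_range_mulVecLin (B : Matrix n n ℤ) (hB : B.det ≠ 0) :
    (LinearMap.range B.mulVecLin).toAddSubgroup.index = B.det.natAbs := by
  have hinj : Function.Injective B.mulVecLin := Matrix.mulVec_injective_of_det_ne_zero hB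
  have h := Submodule.natAbs_det_equiv _ (LinearEquiv.ofInjective B.mulVecLin hinj)
  rw [AddSubgroup.index]
  refine Eq.trans h.symm ?_
  rw [← LinearMap.det_toLin' B]
  rfl

end Matrix

/-! ### The critical group and the matrix-tree theorem -/

namespace Multigraph

section CriticalGroup

variable {V E : Type*} (G : Multigraph V E)

/-- The sum of the values of a function at the two endpoints of an unordered pair. -/
def pairSum {X R : Type*} [AddCommMonoid R] (f : X → R) : Sym2 X → R :=
  Sym2.lift ⟨fun a b => f a + f b, fun _ _ => add_comm _ _⟩

@[simp]
theorem pairSum_mk {X R : Type*} [AddCommMonoid R] (f : X → R) (a b : X) :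
    pairSum f s(a, b) = f a + f b := rfl

theorem pairSum_comp {X Y R : Type*} [AddCommMonoid R] (f : Y → R) (φ : X → Y) (z : Sym2 X) :
    pairSum (f ∘ φ) z = pairSum f (z.map φ) := by
  induction z with | _ a b => rfl

theorem laplacian_symm (u v : V) : G.laplacian u v = G.laplacian v u := by
  have h : ∀ e, G.ends e = s(u, v) ↔ G.ends e = s(v, u) := fun e => by rw [Sym2.eq_swap]
  simp only [laplacian, Matrix.sub_apply, adjMatrix, degMatrix, Matrix.of_apply, h,
    Matrix.diagonal_apply]
  congr 1
  by_cases huv : u = v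
  · subst huv; rfl
  · rw [if_neg huv, if_neg (Ne.symm huv)]

open Classical in
/-- The Laplacian as a sum over edges: an edge with endpoints `x` and `y` contributes
`f y - f x = (f x + f y) - 2 * f x` to the value at `x`. -/
theorem sum_laplacian_mul [Fintype V] [Fintype E] {R : Type*} [CommRing R] (f : V → R) (x : V) :
    ∑ y, (G.laplacian x y : R) * f y =
      ∑ e with x ∈ G.ends e, (pairSum f (G.ends e) - 2 * f x) := by
  have hadj : ∀ y, (G.adjMatrix x y : R) = ∑ e, if G.ends e = s(x, y) then 1 else 0 := fun y => by
    simp [adjMatrix, Nat.card_eq_fintype_card, Fintype.card_subtype]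
  have hdeg : ∀ y, (G.degMatrix x y : R) =
      if x = y then ∑ e, if x ∈ G.ends e then 1 else 0 else 0 := fun y => by
    simp only [degMatrix, Matrix.diagonal_apply]
    split_ifs <;> simp [Nat.card_eq_fintype_card, Fintype.card_subtype]
  have hedge : ∀ e, (∑ y, if G.ends e = s(x, y) then f y else 0) =
      if x ∈ G.ends e then pairSum f (G.ends e) - f x else 0 := fun e => by
    have hl := G.loopless e
    induction hz : G.ends e with | _ a b
    rw [hz, Sym2.mk_isDiag_iff] at hl
    simp only [Sym2.mem_iff]
    by_cases hxa : x = a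
    · subst hxa
      simp [hl, Ne.symm hl]
    · by_cases hxb : x = b
      · subst hxb
        simp [hl, Ne.symm hl]
      · simp [Ne.symm hxa, Ne.symm hxb, hxa, hxb]
  simp only [laplacian, Matrix.sub_apply, Int.cast_sub, sub_mul, Finset.sum_sub_distrib, hadj, hdeg,
    Finset.sum_mul, ite_mul, one_mul, zero_mul]
  rw [Finset.sum_comm]
  simp only [hedge, Finset.sum_ite_eq, Finset.mem_univ, if_true, Finset.sum_filter]
  rw [← Finset.sum_sub_distrib, ← Finset.sum_sub_distrib]
  refine Finset.sum_congr rfl fun e _ => ?_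
  split_ifs <;> ring

theorem laplacian_mulVec_one [Fintype V] [Finite E] : G.laplacian.mulVec 1 = 0 := by
  classical
  cases nonempty_fintype E
  ext x
  have h := G.sum_laplacian_mul (R := ℤ) 1 x
  simp only [Int.cast_id] at h
  rw [Matrix.mulVec, dotProduct, h]
  refine Finset.sum_eq_zero fun e _ => ?_
  induction G.ends e with | _ a b => simp

theorem transpose_laplacian : G.laplacian.transpose = G.laplacian :=
  Matrix.ext fun _ _ => G.laplacian_symm _ _

theorem one_vecMul_laplacian [Fintype V] [Finite E] : Matrix.vecMul 1 G.laplacian = 0 := by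
  rw [← Matrix.mulVec_transpose, transpose_laplacian, laplacian_mulVec_one]

/-- A property of vertices that is transported along edges holds everywhere in a connected graph as
soon as it holds at one vertex. -/
theorem Connected.forall_of_adj {G : Multigraph V E} (hG : G.Connected) {P : V → Prop} {v : V}
    (hv : P v) (h : ∀ e x y, G.ends e = s(x, y) → P x → P y) (w : V) : P w := by
  obtain ⟨p⟩ := hG.preconnected v w
  induction p with
  | nil => exact hv
  | cons hadj _ ih =>
    obtain ⟨e, he⟩ := hadj
    exact ih (h e _ _ he hv)

/-- Maximum principle: harmonic functions on a connected graph are constant. -/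
theorem Connected.eq_of_laplacian_mulVec_eq_zero [Fintype V] [Finite E] {G : Multigraph V E}
    (hG : G.Connected) {f : V → ℤ} (hf : G.laplacian.mulVec f = 0) (v w : V) : f v = f w := by
  classical
  cases nonempty_fintype E
  have : Nonempty V := ⟨v⟩
  obtain ⟨m, hm⟩ := Finite.exists_max f
  have key : ∀ x, f x = f m := by
    refine hG.forall_of_adj (v := m) rfl fun e x y he hx => ?_
    have h0 : ∑ e with x ∈ G.ends e, (pairSum f (G.ends e) - 2 * f x) = 0 := by
      rw [← G.sum_laplacian_mul (R := ℤ) f x]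
      exact congrFun hf x
    have hle : ∀ e ∈ Finset.univ.filter (fun e => x ∈ G.ends e),
        pairSum f (G.ends e) - 2 * f x ≤ 0 := fun e _ => by
      induction G.ends e with | _ a b
      have := hm a
      have := hm b
      simp only [pairSum_mk]
      omega
    have := (Finset.sum_eq_zero_iff_of_nonpos hle).1 h0 e (by simp [he])
    rw [he, pairSum_mk] at this
    omega
  rw [key v, key w]

/-- The Laplacian with `1` added to the diagonal entry of the vertex `v`.  Its
determinant is that of the Laplacian with the row and column of `v` removed, as the Laplacian itself
is singular. -/
noncomputable def pinnedLaplacian [DecidableEq V] (v : V) : Matrix V V ℤ :=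
  G.laplacian + Matrix.vecMulVec (Pi.single v 1) (Pi.single v 1)

theorem pinnedLaplacian_mulVec [Fintype V] [DecidableEq V] (v : V) (f : V → ℤ) :
    (G.pinnedLaplacian v).mulVec f = G.laplacian.mulVec f + Pi.single v (f v) := by
  rw [pinnedLaplacian, Matrix.add_mulVec, Matrix.vecMulVec_mulVec]
  congr 1
  ext x
  by_cases h : x = v
  · subst h; simp
  · simp [h]

theorem sum_laplacian_mulVec [Fintype V] [Finite E] (f : V → ℤ) :
    ∑ x, G.laplacian.mulVec f x = 0 := by
  rw [← one_dotProduct, Matrix.dotProduct_mulVec, one_vecMul_laplacian, zero_dotProduct]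

theorem Connected.det_pinnedLaplacian_ne_zero [Fintype V] [DecidableEq V] [Finite E]
    {G : Multigraph V E} (hG : G.Connected) (v : V) : (G.pinnedLaplacian v).det ≠ 0 := by
  intro h
  obtain ⟨f, hf, h0⟩ := Matrix.exists_mulVec_eq_zero_iff.2 h
  rw [pinnedLaplacian_mulVec] at h0
  have hv : f v = 0 := by
    have := G.sum_laplacian_mulVec f
    rw [eq_neg_of_add_eq_zero_left h0] at this
    simpa using this
  rw [hv, Pi.single_zero, add_zero] at h0
  exact hf (funext fun w => (hG.eq_of_laplacian_mulVec_eq_zero h0 w v).trans hv)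

theorem mem_principal_iff [Fintype V] {δ : V → ℤ} :
    δ ∈ G.principal ↔ ∃ f, G.laplacian.mulVec f = δ := by
  have h : G.principal = (LinearMap.range G.laplacian.mulVecLin).toAddSubgroup := by
    rw [Matrix.range_mulVecLin, Submodule.span_int_eq_addSubgroupClosure]
    rfl
  rw [h]
  rfl

theorem mem_degreeZero_iff [Fintype V] {δ : V → ℤ} : δ ∈ degreeZero V ↔ ∑ v, δ v = 0 := by
  rw [← finsum_eq_sum_of_fintype]
  rfl

/-- A form of the matrix-tree theorem.  The image of the pinned Laplacian contains a divisor of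
degree one and meets the divisors of degree zero in the principal divisors, so its index is the
order of the critical group. -/
theorem Connected.card_criticalGroup [Fintype V] [DecidableEq V] [Finite E]
    {G : Multigraph V E} (hG : G.Connected) (v : V) :
    Nat.card G.CriticalGroup = (G.pinnedLaplacian v).det.natAbs := by
  rw [← Matrix.index_range_mulVecLin _ (hG.det_pinnedLaplacian_ne_zero v)]
  set R := (LinearMap.range (G.pinnedLaplacian v).mulVecLin).toAddSubgroup with hR
  have memR : ∀ δ, δ ∈ R ↔ ∃ f, G.laplacian.mulVec f + Pi.single v (f v) = δ := fun δ => by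
    simp_rw [← pinnedLaplacian_mulVec]
    rfl
  have hinf : R ⊓ degreeZero V = G.principal := by
    ext δ
    rw [AddSubgroup.mem_inf, memR, mem_degreeZero_iff, mem_principal_iff]
    constructor
    · rintro ⟨⟨f, rfl⟩, h⟩
      refine ⟨f, ?_⟩
      have : f v = 0 := by simpa [Finset.sum_add_distrib, G.sum_laplacian_mulVec f] using h
      rw [this, Pi.single_zero, add_zero]
    · rintro ⟨f, rfl⟩
      refine ⟨⟨f - f v • 1, ?_⟩, G.sum_laplacian_mulVec f⟩
      rw [Matrix.mulVec_sub, Matrix.mulVec_smul, laplacian_mulVec_one]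
      simp
  have hsup : R ⊔ degreeZero V = ⊤ := by
    rw [eq_top_iff]
    intro δ _
    have h1 : (∑ x, δ x) • Pi.single v 1 ∈ R := R.zsmul_mem ((memR _).2 ⟨1, by
      rw [laplacian_mulVec_one]; simp⟩) _
    have h2 : δ - (∑ x, δ x) • Pi.single v 1 ∈ degreeZero V := by
      rw [mem_degreeZero_iff]
      simp [← Finset.mul_sum]
    have := AddSubgroup.add_mem_sup h1 h2
    rwa [add_sub_cancel] at this
  have h1 : R.relIndex (degreeZero V) = R.index := by
    rw [← AddSubgroup.relIndex_sup_left, hsup, AddSubgroup.relIndex_top_right]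
  rw [← h1, ← AddSubgroup.inf_relIndex_right, hinf]
  rfl

theorem Connected.finite_criticalGroup [Finite V] [Finite E] {G : Multigraph V E}
    (hG : G.Connected) : Finite G.CriticalGroup := by
  classical
  cases nonempty_fintype V
  obtain ⟨v⟩ := hG.nonempty
  refine Nat.finite_of_card_ne_zero ?_
  rw [hG.card_criticalGroup v, Int.natAbs_ne_zero]
  exact hG.det_pinnedLaplacian_ne_zero v

end CriticalGroup

end Multigraph

/-! ### Harmonic actions and Laplacians of quotients -/

namespace Multigraph

section Harmonic

variable {V E : Type*} {G : Multigraph V E} {H Δ : Subgroup G.Aut}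

theorem mk_vert_eq_iff {x y : V} :
    (Quotient.mk (MulAction.orbitRel Δ V) x) = Quotient.mk _ y ↔ ∃ g ∈ Δ, g • y = x := by
  rw [Quotient.eq, MulAction.orbitRel_apply]
  exact ⟨fun ⟨g, hg⟩ => ⟨g.1, g.2, hg⟩, fun ⟨g, h, hg⟩ => ⟨⟨g, h⟩, hg⟩⟩

theorem mk_edge_eq_iff {x y : E} :
    (Quotient.mk (MulAction.orbitRel Δ E) x) = Quotient.mk _ y ↔ ∃ g ∈ Δ, g • y = x := by
  rw [Quotient.eq, MulAction.orbitRel_apply]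
  exact ⟨fun ⟨g, hg⟩ => ⟨g.1, g.2, hg⟩, fun ⟨g, h, hg⟩ => ⟨⟨g, h⟩, hg⟩⟩

theorem quotEnds_mk (e : E) :
    G.quotEnds Δ (Quotient.mk _ e) = (G.ends e).map (Quotient.mk (MulAction.orbitRel Δ V)) := rfl

theorem quotMap_onEdge_eq_some_iff {e : E} {q : G.QuotEdge Δ} :
    (G.quotMap Δ).onEdge e = some q ↔ Quotient.mk _ e = q.1 := by
  have hq := q.2
  simp only [quotMap, Option.dite_none_left_eq_some, Option.some_inj, Subtype.ext_iff]
  exact ⟨fun ⟨_, h⟩ => h, fun h => ⟨by rwa [h], h⟩⟩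

theorem mem_ends_smul_iff {g : G.Aut} {e : E} {x : V} : g • x ∈ G.ends (g • e) ↔ x ∈ G.ends e := by
  rw [ends_smul, Sym2.mem_map]
  exact ⟨fun ⟨a, ha, h⟩ => MulAction.injective g h ▸ ha, fun h => ⟨x, h, rfl⟩⟩

/-- The quotient of a connected graph is connected. -/
theorem Connected.quot (hG : G.Connected) (Δ : Subgroup G.Aut) : (G.quot Δ).Connected := by
  obtain ⟨v₀⟩ := hG.nonempty
  have : Nonempty (G.QuotVert Δ) := ⟨Quotient.mk _ v₀⟩
  refine ⟨fun a b => ?_⟩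
  induction a using Quotient.inductionOn with | _ v
  induction b using Quotient.inductionOn with | _ w
  revert w
  refine hG.forall_of_adj (v := v) (SimpleGraph.Reachable.refl _) fun e x y he hx => ?_
  by_cases hxy : (Quotient.mk (MulAction.orbitRel Δ V) x) = Quotient.mk _ y
  · rwa [← hxy]
  · refine hx.trans (SimpleGraph.Adj.reachable ⟨⟨Quotient.mk _ e, ?_⟩, ?_⟩)
    · rwa [quotEnds_mk, he]
    · change G.quotEnds Δ (Quotient.mk _ e) = _
      rw [quotEnds_mk, he]
      rfl

/-- Edges at a vertex fixed by `Δ` are not contracted in the quotient by `Δ`. -/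
theorem not_isDiag_quotEnds_of_forall_smul_eq {x : V} (hx : ∀ g ∈ Δ, g • x = x) {e : E}
    (he : x ∈ G.ends e) : ¬ (G.quotEnds Δ (Quotient.mk _ e)).IsDiag := by
  obtain ⟨y, hy⟩ := he
  intro hd
  rw [quotEnds_mk, hy] at hd
  obtain ⟨g, hg, hgy⟩ := mk_vert_eq_iff.1 (Sym2.mk_isDiag_iff.1 hd).symm
  refine G.loopless e ?_
  rw [hy, ← hgy, hx g hg]
  exact Sym2.mk_isDiag_iff.2 rfl

/-- A harmonic action is free on the pairs of a vertex and an edge at it: an element fixing `x` and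
one edge at `x` fixes all edges at `x`, since the fibres at `x` of the quotient by the cyclic group
it generates have the same size; by connectedness it fixes everything. -/
theorem ActsHarmonically.eq_one_of_smul_eq (hH : G.ActsHarmonically H) (hG : G.Connected)
    {g : G.Aut} (hg : g ∈ H) {x : V} {e : E} (hxe : x ∈ G.ends e) (hx : g • x = x)
    (he : g • e = e) : g = 1 := by
  set Δ := Subgroup.zpowers g with hΔ
  have hΔH : Δ ≤ H := by rwa [hΔ, Subgroup.zpowers_le]
  have hfixV : ∀ z : V, g • z = z → ∀ k ∈ Δ, k • z = z := fun z hz k hk => by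
    have : Δ ≤ MulAction.stabilizer G.Aut z := by rwa [hΔ, Subgroup.zpowers_le]
    exact this hk
  have hfixE : ∀ z : E, g • z = z → ∀ k ∈ Δ, k • z = z := fun z hz k hk => by
    have : Δ ≤ MulAction.stabilizer G.Aut z := by rwa [hΔ, Subgroup.zpowers_le]
    exact this hk
  -- one fixed edge at a fixed vertex forces all edges at that vertex to be fixed
  have hall : ∀ (x : V) (e : E), x ∈ G.ends e → g • x = x → g • e = e →
      ∀ e₁, x ∈ G.ends e₁ → g • e₁ = e₁ := by
    intro x e hxe hx he e₁ hxe₁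
    have hd := not_isDiag_quotEnds_of_forall_smul_eq (hfixV x hx) hxe
    have hd₁ := not_isDiag_quotEnds_of_forall_smul_eq (hfixV x hx) hxe₁
    have hc := hH Δ hΔH x ⟨_, hd⟩ ⟨_, hd₁⟩ (Sym2.mem_map.2 ⟨x, hxe, rfl⟩)
      (Sym2.mem_map.2 ⟨x, hxe₁, rfl⟩)
    simp only [quotMap_onEdge_eq_some_iff] at hc
    have h1 : Nat.card {e' : E // x ∈ G.ends e' ∧
        Quotient.mk (MulAction.orbitRel Δ E) e' = Quotient.mk _ e} = 1 := by
      rw [Nat.card_eq_one_iff_unique]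
      refine ⟨⟨fun a b => Subtype.ext ?_⟩, ⟨e, hxe, rfl⟩⟩
      obtain ⟨k, hk, hka⟩ := mk_edge_eq_iff.1 a.2.2
      obtain ⟨l, hl, hlb⟩ := mk_edge_eq_iff.1 b.2.2
      rw [← hka, ← hlb, hfixE e he k hk, hfixE e he l hl]
    rw [h1, eq_comm, Nat.card_eq_one_iff_unique] at hc
    have h2 : g • x ∈ G.ends (g • e₁) := mem_ends_smul_iff.2 hxe₁
    rw [hx] at h2
    exact congrArg Subtype.val (hc.1.elim ⟨g • e₁, h2, mk_edge_eq_iff.2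
      ⟨g, Subgroup.mem_zpowers g, rfl⟩⟩ ⟨e₁, hxe₁, rfl⟩)
  have hP : ∀ v : V, g • v = v ∧ ∀ e, v ∈ G.ends e → g • e = e := by
    refine hG.forall_of_adj (v := x) ⟨hx, hall x e hxe hx he⟩ fun e x y hexy ⟨hx, hxe⟩ => ?_
    have he : g • e = e := hxe e (by simp [hexy])
    have hy : g • y = y := by
      have h := ends_smul G g e
      rw [he, hexy, Sym2.map_mk, hx] at h
      exact (Sym2.congr_right.1 h).symm
    exact ⟨hy, hall y e (by simp [hexy]) hy he⟩
  have hE : ∀ e : E, g • e = e := fun e => by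
    obtain ⟨v, hv⟩ : ∃ v, v ∈ G.ends e := ⟨_, (G.ends e).out_fst_mem⟩
    exact (hP v).2 e hv
  exact Subtype.ext (Prod.ext (Equiv.ext fun v => (hP v).1) (Equiv.ext hE))

/-- The common multiplicity of the quotient map at a vertex is the order of the stabilizer. -/
theorem ActsHarmonically.card_edges_over (hH : G.ActsHarmonically H) (hG : G.Connected)
    (hΔ : Δ ≤ H) (x : V) (q : G.QuotEdge Δ) (hq : Quotient.mk _ x ∈ (G.quot Δ).ends q) :
    Nat.card {e : E // x ∈ G.ends e ∧ Quotient.mk (MulAction.orbitRel Δ E) e = q.1} =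
      Nat.card (MulAction.stabilizer Δ x) := by
  obtain ⟨q, hd⟩ := q
  induction q using Quotient.inductionOn with | _ e₁
  obtain ⟨y, hy, hyx⟩ := Sym2.mem_map.1 hq
  obtain ⟨k, hk, hkx⟩ := mk_vert_eq_iff.1 hyx.symm
  -- an edge at `x` itself in the given orbit
  obtain ⟨e, hxe, hee⟩ : ∃ e, x ∈ G.ends e ∧
      Quotient.mk (MulAction.orbitRel Δ E) e = Quotient.mk _ e₁ :=
    ⟨k • e₁, by rw [← hkx]; exact mem_ends_smul_iff.2 hy, mk_edge_eq_iff.2 ⟨k, hk, rfl⟩⟩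
  simp only [← hee] at hd ⊢
  symm
  refine Nat.card_eq_of_bijective (fun g : MulAction.stabilizer Δ x =>
    (⟨g.1.1 • e, ?_, mk_edge_eq_iff.2 ⟨_, g.1.2, rfl⟩⟩ : {e' : E // x ∈ G.ends e' ∧
      Quotient.mk (MulAction.orbitRel Δ E) e' = Quotient.mk _ e})) ⟨?_, ?_⟩
  · have h2 : g.1.1 • x ∈ G.ends (g.1.1 • e) := mem_ends_smul_iff.2 hxe
    have h3 : g.1.1 • x = x := g.2
    rwa [h3] at h2
  · intro g h hgh
    have h1 : g.1.1 • e = h.1.1 • e := congrArg Subtype.val hgh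
    have hgx : g.1.1 • x = x := g.2
    have hhx : h.1.1 • x = x := h.2
    have h2 : h.1.1⁻¹ * g.1.1 = 1 := by
      refine hH.eq_one_of_smul_eq hG (hΔ (Δ.mul_mem (Δ.inv_mem h.1.2) g.1.2)) hxe ?_ ?_
      · rw [mul_smul, hgx, inv_smul_eq_iff, hhx]
      · rw [mul_smul, h1, inv_smul_smul]
    exact Subtype.ext (Subtype.ext (inv_mul_eq_one.1 h2).symm)
  · rintro ⟨e', hxe', he'⟩
    obtain ⟨g, hg, rfl⟩ := mk_edge_eq_iff.1 he'
    refine ⟨⟨⟨g, hg⟩, ?_⟩, rfl⟩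
    -- otherwise `g⁻¹ • x` is the other endpoint of `e`, and `e` is contracted
    have h1 : g⁻¹ • x ∈ G.ends e := by
      rw [← mem_ends_smul_iff (g := g), smul_inv_smul]
      exact hxe'
    by_contra hne
    refine hd ?_
    have hne' : x ≠ g⁻¹ • x := fun h => hne (by
      change g • x = x
      nth_rw 1 [h]
      rw [smul_inv_smul])
    rw [quotEnds_mk, (Sym2.mem_and_mem_iff hne').1 ⟨hxe, h1⟩, Sym2.map_mk, Sym2.mk_isDiag_iff]
    exact mk_vert_eq_iff.2 ⟨g, hg, smul_inv_smul g x⟩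

open Classical in
/-- The Laplacian of `G` on pulled back functions is that of the quotient, scaled at each vertex by
the order of the stabilizer. -/
theorem ActsHarmonically.sum_laplacian_mul_mk [Fintype V] [Finite E] (hH : G.ActsHarmonically H)
    (hG : G.Connected) (hΔ : Δ ≤ H) {R : Type*} [CommRing R] [Fintype (G.QuotVert Δ)]
    (f : G.QuotVert Δ → R) (x : V) :
    ∑ y, (G.laplacian x y : R) * f (Quotient.mk _ y) =
      Nat.card (MulAction.stabilizer Δ x) *
        ∑ q, ((G.quot Δ).laplacian (Quotient.mk _ x) q : R) * f q := by
  cases nonempty_fintype E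
  set φ := Quotient.mk (MulAction.orbitRel Δ V) with hφ
  set ψ := Quotient.mk (MulAction.orbitRel Δ E) with hψ
  let F : MulAction.orbitRel.Quotient Δ E → R := fun q => pairSum f (G.quotEnds Δ q) - 2 * f (φ x)
  have hL := G.sum_laplacian_mul (f ∘ φ) x
  simp only [Function.comp_apply] at hL
  rw [hL, sum_laplacian_mul]
  have h1 : ∀ e, pairSum (f ∘ φ) (G.ends e) - 2 * f (φ x) = F (ψ e) := fun e => by
    rw [pairSum_comp]
    rfl
  have h2 : ∀ q : G.QuotEdge Δ, pairSum f ((G.quot Δ).ends q) - 2 * f (φ x) = F q.1 := fun _ => rfl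
  simp only [h1, h2]
  have hfib : ∀ q, ∑ e with x ∈ G.ends e ∧ ψ e = q, F (ψ e) =
      (Nat.card {e // x ∈ G.ends e ∧ ψ e = q} : R) * F q := fun q => by
    rw [Finset.sum_congr rfl fun e he => by rw [(Finset.mem_filter.1 he).2.2], Finset.sum_const,
      nsmul_eq_mul, Nat.card_eq_fintype_card, Fintype.card_subtype]
  have hdiag : ∀ q, (Nat.card {e // x ∈ G.ends e ∧ ψ e = q} : R) * F q ≠ 0 →
      ¬ (G.quotEnds Δ q).IsDiag := by
    -- a contracted edge at `x` has both ends over `φ x`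
    rintro q hq hd
    obtain ⟨e, hxe, rfl⟩ : ∃ e, x ∈ G.ends e ∧ ψ e = q := by
      by_contra! hno
      have : IsEmpty {e // x ∈ G.ends e ∧ ψ e = q} := ⟨fun e => hno e.1 e.2.1 e.2.2⟩
      simp at hq
    have hmem : φ x ∈ G.quotEnds Δ (ψ e) := Sym2.mem_map.2 ⟨x, hxe, rfl⟩
    refine hq ?_
    simp only [F]
    induction hz : G.quotEnds Δ (ψ e) with | _ a b
    rw [hz, Sym2.mk_isDiag_iff] at hd
    rw [hz, hd, Sym2.mem_iff, or_self] at hmem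
    rw [hd, hmem, pairSum_mk]
    ring
  rw [← Finset.sum_fiberwise (g := ψ)]
  simp only [Finset.filter_filter, hfib]
  rw [← Finset.sum_filter_of_ne fun q _ => hdiag q,
    Finset.sum_subtype (p := fun q => ¬ (G.quotEnds Δ q).IsDiag) _ (by simp),
    Finset.sum_filter, Finset.mul_sum]
  refine Finset.sum_congr rfl fun q _ => ?_
  split_ifs with h
  · rw [hH.card_edges_over hG hΔ x q h]
  · have : IsEmpty {e // x ∈ G.ends e ∧ ψ e = q.1} := ⟨fun e => h (by
      have : φ x ∈ G.quotEnds Δ (ψ e) := Sym2.mem_map.2 ⟨x, e.2.1, rfl⟩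
      rwa [e.2.2] at this)⟩
    simp

end Harmonic

end Multigraph

/-! ### Invariant functions on the vertices -/

namespace Multigraph

section Invariants

variable {V E : Type*} {G : Multigraph V E}

/-- The operator `f ↦ (x ↦ f (g • x))` on functions on the vertices. -/
def translate (g : G.Aut) : (V → ℚ) →ₗ[ℚ] V → ℚ := LinearMap.funLeft ℚ ℚ (g • ·)

@[simp]
theorem translate_apply (g : G.Aut) (f : V → ℚ) (x : V) : translate g f x = f (g • x) := rfl

/-- Pullback of functions along the quotient map `V → V / Δ`. -/
def pullback (Δ : Subgroup G.Aut) : (G.QuotVert Δ → ℚ) →ₗ[ℚ] V → ℚ :=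
  LinearMap.funLeft ℚ ℚ (Quotient.mk (MulAction.orbitRel Δ V))

@[simp]
theorem pullback_apply (Δ : Subgroup G.Aut) (f : G.QuotVert Δ → ℚ) (x : V) :
    pullback Δ f x = f (Quotient.mk _ x) := rfl

theorem pullback_injective (Δ : Subgroup G.Aut) : Function.Injective (pullback Δ) :=
  LinearMap.funLeft_injective_of_surjective _ _ _ Quotient.mk_surjective

/-- The automorphisms that leave a given function on the vertices invariant. -/
def invariance (f : V → ℚ) : Subgroup G.Aut where
  carrier := {g | translate g f = f}
  one_mem' := funext fun x => congrArg f (one_smul _ x)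
  mul_mem' {g h} hg hh := funext fun x =>
    (congrArg f (mul_smul g h x)).trans ((congrFun hg _).trans (congrFun hh x))
  inv_mem' {g} hg := funext fun x =>
    (congrFun hg _).symm.trans (congrArg f (smul_inv_smul g x))

theorem mem_invariance {f : V → ℚ} {g : G.Aut} : g ∈ invariance f ↔ translate g f = f := Iff.rfl

theorem mem_range_pullback_iff {Δ : Subgroup G.Aut} {f : V → ℚ} :
    f ∈ LinearMap.range (pullback Δ) ↔ Δ ≤ invariance f := by
  constructor
  · rintro ⟨f, rfl⟩ g hg
    exact funext fun x => congrArg f (mk_vert_eq_iff.2 ⟨g, hg, rfl⟩)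
  · intro h
    refine ⟨Quotient.lift f ?_, rfl⟩
    rintro _ x ⟨g, rfl⟩
    exact congrFun (h g.2) x

theorem mem_range_pullback_zpowers_iff {g : G.Aut} {f : V → ℚ} :
    f ∈ LinearMap.range (pullback (Subgroup.zpowers g)) ↔ translate g f = f := by
  rw [mem_range_pullback_iff, Subgroup.zpowers_le, mem_invariance]

theorem mem_range_pullback_closure_pair_iff {σ₁ σ₂ : G.Aut} {f : V → ℚ} :
    f ∈ LinearMap.range (pullback (Subgroup.closure {σ₁, σ₂})) ↔
      translate σ₁ f = f ∧ translate σ₂ f = f := by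
  rw [mem_range_pullback_iff, Subgroup.closure_le, Set.insert_subset_iff,
    Set.singleton_subset_iff]
  rfl

/-- The projection onto the functions invariant under a finite group of automorphisms. -/
noncomputable def average (Δ : Subgroup G.Aut) [Fintype Δ] : (V → ℚ) →ₗ[ℚ] V → ℚ :=
  (Nat.card Δ : ℚ)⁻¹ • ∑ g : Δ, translate g.1

theorem average_apply (Δ : Subgroup G.Aut) [Fintype Δ] (f : V → ℚ) (x : V) :
    average Δ f x = (Nat.card Δ : ℚ)⁻¹ * ∑ g : Δ, f (g.1 • x) := by
  simp [average, LinearMap.sum_apply]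

theorem average_eq_self {Δ : Subgroup G.Aut} [Fintype Δ] {f : V → ℚ} (h : Δ ≤ invariance f) :
    average Δ f = f := by
  ext x
  have h1 : ∀ g : Δ, f (g.1 • x) = f x := fun g => congrFun (h g.2) x
  have h2 : (Fintype.card Δ : ℚ) ≠ 0 := Nat.cast_ne_zero.2 Fintype.card_ne_zero
  simp [average_apply, h1, h2]

theorem translate_average {Δ : Subgroup G.Aut} [Fintype Δ] {g : G.Aut} (hg : g ∈ Δ) (f : V → ℚ) :
    translate g (average Δ f) = average Δ f := by
  ext x
  rw [translate_apply, average_apply, average_apply]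
  congr 1
  refine Fintype.sum_equiv (Equiv.mulRight ⟨g, hg⟩) _ _ fun h => ?_
  simp [mul_smul]

/-- Averaging over a group commutes with an automorphism that inverts all its elements. -/
theorem average_translate {Δ : Subgroup G.Aut} [Fintype Δ] {σ : G.Aut}
    (hσ : ∀ g ∈ Δ, σ * g = g⁻¹ * σ) (f : V → ℚ) :
    average Δ (translate σ f) = translate σ (average Δ f) := by
  ext x
  rw [translate_apply, average_apply, average_apply]
  congr 1
  refine Fintype.sum_equiv (Equiv.inv Δ) _ _ fun g => ?_
  simp [← mul_smul, hσ g.1 g.2]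

/-- The Brauer relation for the permutation action of two involutions `σ₁` and `σ₂`: the
determinants of an equivariant operator on the functions on `V` and on the quotients of `V`. -/
theorem det_mul_det_sq_eq [Finite V] {σ₁ σ₂ : G.Aut} (h₁ : σ₁ * σ₁ = 1)
    (h₂ : σ₂ * σ₂ = 1) [Finite G.Aut] {T : (V → ℚ) →ₗ[ℚ] V → ℚ}
    (hT : ∀ (g : G.Aut) f, T (translate g f) = translate g (T f))
    (TΔ : ∀ Δ : Subgroup G.Aut, (G.QuotVert Δ → ℚ) →ₗ[ℚ] G.QuotVert Δ → ℚ)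
    (hTΔ : ∀ Δ ≤ Subgroup.closure {σ₁, σ₂}, ∀ f, pullback Δ (TΔ Δ f) = T (pullback Δ f)) :
    LinearMap.det T * LinearMap.det (TΔ (Subgroup.closure {σ₁, σ₂})) ^ 2 =
      LinearMap.det (TΔ (Subgroup.zpowers σ₁)) * LinearMap.det (TΔ (Subgroup.zpowers σ₂)) *
        LinearMap.det (TΔ (Subgroup.zpowers (σ₁ * σ₂))) := by
  classical
  cases nonempty_fintype (Subgroup.zpowers (σ₁ * σ₂))
  have hinv : ∀ σ : G.Aut, σ * (σ₁ * σ₂) = (σ₁ * σ₂)⁻¹ * σ →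
      ∀ g ∈ Subgroup.zpowers (σ₁ * σ₂), σ * g = g⁻¹ * σ := by
    rintro σ hσ _ ⟨k, rfl⟩
    have : SemiconjBy σ (σ₁ * σ₂) (σ₁ * σ₂)⁻¹ := hσ
    have hk := this.zpow_right k
    rwa [inv_zpow] at hk
  have i₁ : σ₁⁻¹ = σ₁ := inv_eq_of_mul_eq_one_right h₁
  have i₂ : σ₂⁻¹ = σ₂ := inv_eq_of_mul_eq_one_right h₂
  have m₁ : σ₁ ∈ Subgroup.closure {σ₁, σ₂} := Subgroup.subset_closure (by simp)
  have m₂ : σ₂ ∈ Subgroup.closure {σ₁, σ₂} := Subgroup.subset_closure (by simp)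
  have hts : ∀ f : V → ℚ, translate σ₂ (translate σ₁ f) = translate (σ₁ * σ₂) f := fun f =>
    funext fun x => congrArg f (mul_smul σ₁ σ₂ x).symm
  have hsq : ∀ σ : G.Aut, σ * σ = 1 → ∀ f : V → ℚ, translate σ (translate σ f) = f :=
    fun σ hσ f => funext fun x =>
      congrArg f ((mul_smul σ σ x).symm.trans (by rw [hσ, one_smul]))
  refine LinearMap.det_mul_det_sq_eq_of_involutions (s := translate σ₁) (t := translate σ₂)
    (p := average (Subgroup.zpowers (σ₁ * σ₂))) (hsq σ₁ h₁) (hsq σ₂ h₂) ?_ ?_ ?_ ?_ ?_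
    (fun f => (hT _ f).symm) (fun f => (hT _ f).symm)
    (pullback_injective _) (fun _ => mem_range_pullback_zpowers_iff)
    (hTΔ _ (by rwa [Subgroup.zpowers_le]))
    (pullback_injective _) (fun _ => mem_range_pullback_zpowers_iff)
    (hTΔ _ (by rwa [Subgroup.zpowers_le]))
    (pullback_injective _) (fun f => ?_)
    (hTΔ _ (by rw [Subgroup.zpowers_le]; exact Subgroup.mul_mem _ m₁ m₂))
    (pullback_injective _) (fun _ => mem_range_pullback_closure_pair_iff) (hTΔ _ le_rfl)
  · intro f hf
    rw [hts] at hf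
    exact average_eq_self (by rwa [Subgroup.zpowers_le, mem_invariance])
  · intro f
    rw [hts, translate_average (Subgroup.mem_zpowers _)]
  · refine average_translate (hinv σ₁ ?_)
    rw [mul_inv_rev, i₁, i₂, ← mul_assoc, h₁, mul_assoc, h₁, one_mul, mul_one]
  · refine average_translate (hinv σ₂ ?_)
    rw [mul_inv_rev, i₁, i₂, mul_assoc]
  · intro f
    simp [average, LinearMap.sum_apply, hT]
  · rw [hts]
    exact mem_range_pullback_zpowers_iff

end Invariants

/-! ### The Laplacian on invariant functions -/

section Operator

variable {V E : Type*} {G : Multigraph V E} {H Δ : Subgroup G.Aut}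

theorem laplacian_smul (g : G.Aut) (x y : V) : G.laplacian (g • x) (g • y) = G.laplacian x y := by
  have hadj : Nat.card {e : E // G.ends e = s(g • x, g • y)} =
      Nat.card {e : E // G.ends e = s(x, y)} := by
    refine (Nat.card_congr (Equiv.subtypeEquiv (MulAction.toPerm g) fun e => ?_)).symm
    rw [MulAction.toPerm_apply, ends_smul, ← Sym2.map_mk]
    exact (Sym2.map.injective (MulAction.injective g)).eq_iff.symm
  have hdeg : Nat.card {e : E // g • x ∈ G.ends e} = Nat.card {e : E // x ∈ G.ends e} :=
    (Nat.card_congr (Equiv.subtypeEquiv (MulAction.toPerm g) fun _ =>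
      mem_ends_smul_iff.symm)).symm
  simp only [laplacian, Matrix.sub_apply, adjMatrix, degMatrix, Matrix.of_apply, hadj,
    Matrix.diagonal_apply, hdeg]
  congr 1
  by_cases hxy : x = y
  · rw [if_pos hxy, if_pos (by rw [hxy])]
  · rw [if_neg hxy, if_neg fun h => hxy (MulAction.injective g h)]

/-- A form of the matrix-tree theorem for rank one perturbations of the Laplacian. -/
theorem Connected.abs_det_laplacian_add_vecMulVec [Fintype V] [DecidableEq V] [Finite E]
    (hG : G.Connected) (u w : V → ℚ) :
    |(G.laplacian.map (Int.cast : ℤ → ℚ) + Matrix.vecMulVec u w).det| =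
      |∑ x, u x| * |∑ x, w x| * Nat.card G.CriticalGroup := by
  obtain ⟨v⟩ := hG.nonempty
  have hr : (G.laplacian.map (Int.cast : ℤ → ℚ)).mulVec 1 = 0 := by
    ext x
    have := congrArg (Int.cast : ℤ → ℚ) (congrFun G.laplacian_mulVec_one x)
    simpa [Matrix.mulVec, dotProduct] using this
  have hc : Matrix.vecMul 1 (G.laplacian.map (Int.cast : ℤ → ℚ)) = 0 := by
    ext x
    have := congrArg (Int.cast : ℤ → ℚ) (congrFun G.one_vecMul_laplacian x)
    simpa [Matrix.vecMul, dotProduct] using this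
  have hp : G.laplacian.map (Int.cast : ℤ → ℚ) +
      Matrix.vecMulVec (Pi.single v 1) (Pi.single v 1) =
        (G.pinnedLaplacian v).map (Int.cast : ℤ → ℚ) := by
    ext x y
    simp [pinnedLaplacian, Matrix.vecMulVec_apply, Pi.single_apply]
  have hd : ((G.pinnedLaplacian v).map (Int.cast : ℤ → ℚ)).det = (G.pinnedLaplacian v).det :=
    (Int.cast_det _).symm
  rw [Matrix.det_add_vecMulVec_of_sum_eq_zero _ hr hc u w v, hp, hd, abs_mul, abs_mul,
    hG.card_criticalGroup v, Nat.cast_natAbs, Int.cast_abs]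

/-- The order of the stabilizers of the vertices in an orbit. -/
noncomputable def stabCard (Δ : Subgroup G.Aut) (q : G.QuotVert Δ) : ℕ :=
  Nat.card (MulAction.stabilizer Δ q.out)

theorem stabCard_mk (Δ : Subgroup G.Aut) (x : V) :
    stabCard Δ (Quotient.mk _ x) = Nat.card (MulAction.stabilizer Δ x) :=
  Nat.card_congr (MulAction.stabilizerEquivStabilizerOfOrbitRel
    (Quotient.mk_out (s := MulAction.orbitRel Δ V) x)).toEquiv

/-- The number of vertices in an orbit. -/
noncomputable def orbitCard (Δ : Subgroup G.Aut) (q : G.QuotVert Δ) : ℕ :=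
  Nat.card {x : V // Quotient.mk (MulAction.orbitRel Δ V) x = q}

theorem orbitCard_mk (Δ : Subgroup G.Aut) (x : V) :
    orbitCard Δ (Quotient.mk _ x) = (MulAction.orbit Δ x).ncard := by
  rw [← Nat.card_coe_set_eq]
  refine Nat.card_congr (Equiv.subtypeEquivRight fun y => ?_)
  rw [Quotient.eq, MulAction.orbitRel_apply]

theorem stabCard_mul_orbitCard (Δ : Subgroup G.Aut) (q : G.QuotVert Δ) :
    stabCard Δ q * orbitCard Δ q = Nat.card Δ := by
  induction q using Quotient.inductionOn with | _ x
  rw [stabCard_mk, orbitCard_mk, ← MulAction.index_stabilizer, Subgroup.card_mul_index]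

theorem sum_comp_mk [Fintype V] [Fintype (G.QuotVert Δ)] (f : G.QuotVert Δ → ℚ) :
    ∑ x : V, f (Quotient.mk _ x) = ∑ q, orbitCard Δ q * f q := by
  classical
  rw [← Finset.sum_fiberwise (g := Quotient.mk (MulAction.orbitRel Δ V))]
  refine Finset.sum_congr rfl fun q _ => ?_
  rw [Finset.sum_congr rfl fun x hx => by rw [(Finset.mem_filter.1 hx).2], Finset.sum_const,
    nsmul_eq_mul, orbitCard, Nat.card_eq_fintype_card, Fintype.card_subtype]

variable (G) in
/-- The Laplacian plus the all-ones matrix, as an operator on functions on the vertices.  It is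
invertible for connected graphs. -/
noncomputable def shiftedLaplacian [Fintype V] : (V → ℚ) →ₗ[ℚ] V → ℚ :=
  (G.laplacian.map (Int.cast : ℤ → ℚ) + Matrix.vecMulVec 1 1).mulVecLin

theorem shiftedLaplacian_apply [Fintype V] (f : V → ℚ) (x : V) :
    G.shiftedLaplacian f x = ∑ y, (G.laplacian x y : ℚ) * f y + ∑ y, f y := by
  simp [shiftedLaplacian, Matrix.mulVec, dotProduct]

theorem shiftedLaplacian_translate [Fintype V] (g : G.Aut) (f : V → ℚ) :
    G.shiftedLaplacian (translate g f) = translate g (G.shiftedLaplacian f) := by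
  ext x
  simp only [translate_apply, shiftedLaplacian_apply]
  congr 1
  · exact Fintype.sum_equiv (MulAction.toPerm g) _ _ fun y => by
      rw [MulAction.toPerm_apply, laplacian_smul]
  · exact Fintype.sum_equiv (MulAction.toPerm g) _ _ fun y => rfl

theorem Connected.abs_det_shiftedLaplacian [Fintype V] [Finite E] (hG : G.Connected) :
    |LinearMap.det G.shiftedLaplacian| = (Nat.card V : ℚ) ^ 2 * Nat.card G.CriticalGroup := by
  classical
  have h := hG.abs_det_laplacian_add_vecMulVec 1 1
  rw [shiftedLaplacian, ← Matrix.toLin'_apply', LinearMap.det_toLin', h]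
  simp [pow_two]

open Classical in
/-- The operator induced by the shifted Laplacian on functions on the quotient by `Δ`. -/
noncomputable def quotShiftedLaplacian (Δ : Subgroup G.Aut) [Fintype (G.QuotVert Δ)] :
    (G.QuotVert Δ → ℚ) →ₗ[ℚ] G.QuotVert Δ → ℚ :=
  (Matrix.diagonal (fun q => (stabCard Δ q : ℚ)) *
    ((G.quot Δ).laplacian.map (Int.cast : ℤ → ℚ) +
      Matrix.vecMulVec (fun q => (stabCard Δ q : ℚ)⁻¹) fun q => (orbitCard Δ q : ℚ))).mulVecLin

variable [Finite V]

theorem stabCard_pos [Finite E] (q : G.QuotVert Δ) : 0 < stabCard Δ q := Nat.card_pos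

theorem pullback_quotShiftedLaplacian [Fintype V] [Finite E] (hH : G.ActsHarmonically H)
    (hG : G.Connected) (hΔ : Δ ≤ H) [Fintype (G.QuotVert Δ)] (f : G.QuotVert Δ → ℚ) :
    pullback Δ (quotShiftedLaplacian Δ f) = G.shiftedLaplacian (pullback Δ f) := by
  ext x
  have h0 : (stabCard Δ (Quotient.mk _ x) : ℚ) ≠ 0 := Nat.cast_ne_zero.2 (stabCard_pos _).ne'
  simp only [pullback_apply, shiftedLaplacian_apply]
  rw [hH.sum_laplacian_mul_mk hG hΔ, sum_comp_mk, ← stabCard_mk]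
  simp only [quotShiftedLaplacian, Matrix.mulVecLin_apply, ← Matrix.mulVec_mulVec,
    Matrix.mulVec_diagonal, Matrix.add_mulVec, Pi.add_apply, Matrix.vecMulVec_mulVec, mul_add]
  congr 1
  simp [dotProduct]
  field_simp

theorem sum_orbitCard (Δ : Subgroup G.Aut) [Fintype (G.QuotVert Δ)] :
    ∑ q, (orbitCard Δ q : ℚ) = Nat.card V := by
  cases nonempty_fintype V
  have := (sum_comp_mk (Δ := Δ) fun _ => 1).symm
  simpa using this

theorem sum_inv_stabCard [Finite E] (Δ : Subgroup G.Aut) [Fintype (G.QuotVert Δ)] :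
    ∑ q, (stabCard Δ q : ℚ)⁻¹ = Nat.card V / Nat.card Δ := by
  have hΔ : (Nat.card Δ : ℚ) ≠ 0 := Nat.cast_ne_zero.2 Nat.card_pos.ne'
  rw [← sum_orbitCard Δ, Finset.sum_div]
  refine Finset.sum_congr rfl fun q _ => ?_
  have h0 : (stabCard Δ q : ℚ) ≠ 0 := Nat.cast_ne_zero.2 (stabCard_pos _).ne'
  rw [eq_div_iff hΔ, ← stabCard_mul_orbitCard Δ q, Nat.cast_mul, inv_mul_cancel_left₀ h0]

theorem Connected.abs_det_quotShiftedLaplacian [Finite E] (hG : G.Connected)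
    (Δ : Subgroup G.Aut) [Fintype (G.QuotVert Δ)] :
    |LinearMap.det (quotShiftedLaplacian Δ)| * Nat.card Δ =
      (∏ q, stabCard Δ q : ℕ) * (Nat.card V : ℚ) ^ 2 * Nat.card (G.quot Δ).CriticalGroup := by
  classical
  have hΔ : (Nat.card Δ : ℚ) ≠ 0 := Nat.cast_ne_zero.2 Nat.card_pos.ne'
  have h := (hG.quot Δ).abs_det_laplacian_add_vecMulVec (fun q => (stabCard Δ q : ℚ)⁻¹)
    fun q => (orbitCard Δ q : ℚ)
  rw [quotShiftedLaplacian, ← Matrix.toLin'_apply', LinearMap.det_toLin', Matrix.det_mul, abs_mul,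
    Matrix.det_diagonal, h, sum_inv_stabCard, sum_orbitCard, ← Nat.cast_prod,
    Nat.abs_cast, abs_div, Nat.abs_cast, Nat.abs_cast]
  field_simp

/-- If all stabilizers have order at most two, the product of their orders over the orbits is a
power of two whose exponent is determined by the number of orbits. -/
theorem exists_prod_stabCard_eq_two_pow [Finite E] (Δ : Subgroup G.Aut) [Fintype (G.QuotVert Δ)]
    (h : ∀ q : G.QuotVert Δ, stabCard Δ q = 1 ∨ stabCard Δ q = 2) :
    ∃ a : ℕ, ∏ q, stabCard Δ q = 2 ^ a ∧
      (a : ℚ) = 2 * Nat.card (G.QuotVert Δ) - 2 * Nat.card V / Nat.card Δ := by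
  refine ⟨∑ q, (stabCard Δ q - 1), ?_, ?_⟩
  · rw [← Finset.prod_pow_eq_pow_sum]
    refine Finset.prod_congr rfl fun q _ => ?_
    rcases h q with h | h <;> simp [h]
  · -- `m - 1 = 2 - 2 / m` for `m = 1` and `m = 2`
    have h1 : ∀ q : G.QuotVert Δ, ((stabCard Δ q - 1 : ℕ) : ℚ) = 2 - 2 * (stabCard Δ q : ℚ)⁻¹ :=
      fun q => by rcases h q with h | h <;> simp [h]; norm_num
    rw [Nat.cast_sum, Finset.sum_congr rfl fun q _ => h1 q, Finset.sum_sub_distrib,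
      ← Finset.mul_sum, sum_inv_stabCard]
    simp
    ring

end Operator

end Multigraph

/-! ### Orders, orbits and stabilizers for two involutions -/

/-- The group generated by two involutions `a` and `b` is the disjoint union of the cyclic group
generated by `a * b` and its coset containing `a`. -/
theorem card_closure_pair_eq_two_mul {Γ : Type*} [Group Γ] {a b : Γ} (ha : orderOf a = 2)
    (hb : orderOf b = 2) :
    Nat.card (Subgroup.closure {a, b}) = 2 * Nat.card (Subgroup.zpowers (a * b)) := by
  have ha' : a * a = 1 := by rw [← pow_two, ← ha, pow_orderOf_eq_one]
  have hb' : b * b = 1 := by rw [← pow_two, ← hb, pow_orderOf_eq_one]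
  have ia : a⁻¹ = a := inv_eq_of_mul_eq_one_right ha'
  have ib : b⁻¹ = b := inv_eq_of_mul_eq_one_right hb'
  have ma : a ∈ Subgroup.closure {a, b} := Subgroup.subset_closure (by simp)
  have mb : b ∈ Subgroup.closure {a, b} := Subgroup.subset_closure (by simp)
  set R := Subgroup.zpowers (a * b) with hR
  have hab : a * b ∈ R := Subgroup.mem_zpowers _
  have hRle : R ≤ Subgroup.closure {a, b} := by
    rw [hR, Subgroup.zpowers_le]
    exact Subgroup.mul_mem _ ma mb
  -- if `a` were a power of `a * b`, then `a` and `b` would commute and `a * b` have order two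
  have haR : a ∉ R := by
    rintro ⟨k, hk⟩
    have hc : Commute ((a * b) ^ k) (a * b) := (Commute.refl _).zpow_left k
    have hk' : (a * b) ^ k = a := hk
    rw [hk'] at hc
    have hba : b = a * (b * a) := by
      have := hc.eq
      rwa [← mul_assoc, ha', one_mul, mul_assoc] at this
    have hsq : (a * b) ^ (2 : ℤ) = 1 := by
      rw [zpow_two, ← mul_assoc, mul_assoc a b a, ← hba, hb']
    rcases Int.even_or_odd' k with ⟨m, rfl | rfl⟩
    · rw [zpow_mul, hsq, one_zpow] at hk'
      rw [← hk', orderOf_one] at ha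
      omega
    · rw [zpow_add, zpow_mul, hsq, one_zpow, one_mul, zpow_one, mul_eq_left] at hk'
      rw [hk', orderOf_one] at hb
      omega
  have hor : ∀ g ∈ Subgroup.closure {a, b}, g * a ∈ R ∨ g ∈ R := by
    have hstep : ∀ g c, c ∈ ({a, b} : Set Γ) → g * a ∈ R ∨ g ∈ R → g * c * a ∈ R ∨ g * c ∈ R := by
      rintro g c (rfl | rfl) (h | h)
      · exact Or.inr h
      · left; rwa [mul_assoc, ha', mul_one]
      · right
        have := R.mul_mem h hab
        rwa [← mul_assoc, mul_assoc g a a, ha', mul_one] at this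
      · left
        have := R.mul_mem h (R.inv_mem hab)
        rwa [mul_inv_rev, ia, ib, ← mul_assoc] at this
    intro g hg
    induction hg using Subgroup.closure_induction_right with
    | one => exact Or.inr R.one_mem
    | mul_right x _ y hy ih => exact hstep x y hy ih
    | mul_inv_cancel x _ y hy ih =>
      have : y⁻¹ = y := by
        rcases hy with rfl | rfl
        exacts [ia, ib]
      rw [this]
      exact hstep x y hy ih
  have hindex : (R.subgroupOf (Subgroup.closure {a, b})).index = 2 := by
    rw [Subgroup.index_eq_two_iff]
    refine ⟨⟨a, ma⟩, fun g => ?_⟩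
    simp only [Subgroup.mem_subgroupOf, Subgroup.coe_mul]
    rcases hor g.1 g.2 with h | h
    · refine Or.inl ⟨h, fun h' => haR ?_⟩
      simpa using R.mul_mem (R.inv_mem h') h
    · refine Or.inr ⟨h, fun h' => haR ?_⟩
      simpa using R.mul_mem (R.inv_mem h) h'
  rw [← Subgroup.card_mul_index (R.subgroupOf (Subgroup.closure {a, b})), hindex, mul_comm,
    Nat.card_congr (Subgroup.subgroupOfEquivOfLe hRle).toEquiv]

namespace Multigraph

variable {V E : Type*} {G : Multigraph V E}

theorem det_two_smul_id (X : Type*) [Finite X] :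
    LinearMap.det ((2 : ℚ) • (LinearMap.id : (X → ℚ) →ₗ[ℚ] X → ℚ)) = 2 ^ Nat.card X := by
  cases nonempty_fintype X
  simp [LinearMap.det_smul]

/-- The Brauer relation for the numbers of orbits of two involutions. -/
theorem card_add_two_mul_card_quotVert [Finite V] [Finite E] {σ₁ σ₂ : G.Aut} (h₁ : σ₁ * σ₁ = 1)
    (h₂ : σ₂ * σ₂ = 1) :
    Nat.card V + 2 * Nat.card (G.QuotVert (Subgroup.closure {σ₁, σ₂})) =
      Nat.card (G.QuotVert (Subgroup.zpowers σ₁)) + Nat.card (G.QuotVert (Subgroup.zpowers σ₂)) +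
        Nat.card (G.QuotVert (Subgroup.zpowers (σ₁ * σ₂))) := by
  -- the operator `2 • id` has determinant `2 ^ dim` on each space of functions
  have h := det_mul_det_sq_eq h₁ h₂ (T := (2 : ℚ) • LinearMap.id) (fun g f => by simp)
    (fun _ => (2 : ℚ) • LinearMap.id) (fun _ _ f => by simp)
  simp only [det_two_smul_id] at h
  rw [← pow_mul, ← pow_add, ← pow_add, ← pow_add] at h
  have := pow_right_injective₀ (two_pos : (0 : ℚ) < 2) (by norm_num) h
  omega

/-- In a group of order `2 * n` with orbits of size `n` or `2 * n`, and in its subgroups, all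
stabilizers have order at most two. -/
theorem stabCard_eq_one_or_two [Finite V] [Finite E] {H Δ : Subgroup G.Aut} {n : ℕ} (hn : 0 < n)
    (hH : Nat.card H = 2 * n) (hΔ : Δ ≤ H)
    (horb : ∀ v : V, (MulAction.orbit H v).ncard = n ∨ (MulAction.orbit H v).ncard = 2 * n)
    (q : G.QuotVert Δ) : stabCard Δ q = 1 ∨ stabCard Δ q = 2 := by
  have hpos := stabCard_pos q
  induction q using Quotient.inductionOn with | _ x
  have h1 := stabCard_mul_orbitCard H (Quotient.mk _ x)
  rw [orbitCard_mk, stabCard_mk, hH] at h1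
  have h2 : Nat.card (MulAction.stabilizer H x) ≤ 2 := by
    rcases horb x with h | h <;> rw [h] at h1 <;> nlinarith
  have h3 : Nat.card (MulAction.stabilizer Δ x) ≤ Nat.card (MulAction.stabilizer H x) :=
    Nat.card_le_card_of_injective
      (fun g => (⟨⟨g.1.1, hΔ g.1.2⟩, g.2⟩ : MulAction.stabilizer H x)) fun g h hgh =>
        Subtype.ext (Subtype.ext (congrArg (fun k => k.1.1) hgh))
  rw [stabCard_mk] at hpos ⊢
  omega

end Multigraph

/-! ### The formula for dihedral quotients -/

open Multigraph in
theorem mainTheorem2 {V E : Type*} [Finite V] [Finite E] (G : Multigraph V E)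
    (hG : G.Connected) (n : ℕ) (σ₁ σ₂ : G.Aut) (h₁ : orderOf σ₁ = 2) (h₂ : orderOf σ₂ = 2)
    (hD : Nonempty (Subgroup.closure {σ₁, σ₂} ≃* DihedralGroup n))
    (hharm : G.ActsHarmonically (Subgroup.closure {σ₁, σ₂}))
    (horb : ∀ v : V, (MulAction.orbit (Subgroup.closure {σ₁, σ₂}) v).ncard = n ∨
      (MulAction.orbit (Subgroup.closure {σ₁, σ₂}) v).ncard = 2 * n) :
    Finite G.CriticalGroup ∧
    Finite (G.quot (Subgroup.closure {σ₁, σ₂})).CriticalGroup ∧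
    Finite (G.quot (Subgroup.zpowers σ₁)).CriticalGroup ∧
    Finite (G.quot (Subgroup.zpowers σ₂)).CriticalGroup ∧
    Finite (G.quot (Subgroup.zpowers (σ₁ * σ₂))).CriticalGroup ∧
    Nat.card G.CriticalGroup *
        Nat.card (G.quot (Subgroup.closure {σ₁, σ₂})).CriticalGroup ^ 2 =
      n * Nat.card (G.quot (Subgroup.zpowers σ₁)).CriticalGroup *
        Nat.card (G.quot (Subgroup.zpowers σ₂)).CriticalGroup *
        Nat.card (G.quot (Subgroup.zpowers (σ₁ * σ₂))).CriticalGroup := by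
  refine ⟨hG.finite_criticalGroup, (hG.quot _).finite_criticalGroup,
    (hG.quot _).finite_criticalGroup, (hG.quot _).finite_criticalGroup,
    (hG.quot _).finite_criticalGroup, ?_⟩
  classical
  cases nonempty_fintype V
  have : ∀ Δ : Subgroup G.Aut, Fintype (G.QuotVert Δ) := fun Δ => Fintype.ofFinite _
  have s₁ : σ₁ * σ₁ = 1 := by rw [← pow_two, ← h₁, pow_orderOf_eq_one]
  have s₂ : σ₂ * σ₂ = 1 := by rw [← pow_two, ← h₂, pow_orderOf_eq_one]
  have m₁ : σ₁ ∈ Subgroup.closure {σ₁, σ₂} := Subgroup.subset_closure (by simp)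
  have m₂ : σ₂ ∈ Subgroup.closure {σ₁, σ₂} := Subgroup.subset_closure (by simp)
  have l₁ : Subgroup.zpowers σ₁ ≤ Subgroup.closure {σ₁, σ₂} := by rwa [Subgroup.zpowers_le]
  have l₂ : Subgroup.zpowers σ₂ ≤ Subgroup.closure {σ₁, σ₂} := by rwa [Subgroup.zpowers_le]
  have l₃ : Subgroup.zpowers (σ₁ * σ₂) ≤ Subgroup.closure {σ₁, σ₂} := by
    rw [Subgroup.zpowers_le]
    exact Subgroup.mul_mem _ m₁ m₂
  obtain ⟨e⟩ := hD
  have cΓ : Nat.card (Subgroup.closure {σ₁, σ₂}) = 2 * n := by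
    rw [Nat.card_congr e.toEquiv, DihedralGroup.nat_card]
  have c₁ : Nat.card (Subgroup.zpowers σ₁) = 2 := by rw [Nat.card_zpowers, h₁]
  have c₂ : Nat.card (Subgroup.zpowers σ₂) = 2 := by rw [Nat.card_zpowers, h₂]
  have c₃ : Nat.card (Subgroup.zpowers (σ₁ * σ₂)) = n := by
    have := card_closure_pair_eq_two_mul h₁ h₂
    omega
  have hn : 0 < n := by
    rw [← c₃]
    exact Nat.card_pos
  have hst := fun {Δ} (hΔ : Δ ≤ Subgroup.closure {σ₁, σ₂}) =>
    exists_prod_stabCard_eq_two_pow Δ (stabCard_eq_one_or_two hn cΓ hΔ horb)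
  obtain ⟨a, pΓ, ha⟩ := hst le_rfl
  obtain ⟨a₁, p₁, ha₁⟩ := hst l₁
  obtain ⟨a₂, p₂, ha₂⟩ := hst l₂
  obtain ⟨a₃, p₃, ha₃⟩ := hst l₃
  have dΓ := hG.abs_det_quotShiftedLaplacian (Subgroup.closure {σ₁, σ₂})
  have d₁ := hG.abs_det_quotShiftedLaplacian (Subgroup.zpowers σ₁)
  have d₂ := hG.abs_det_quotShiftedLaplacian (Subgroup.zpowers σ₂)
  have d₃ := hG.abs_det_quotShiftedLaplacian (Subgroup.zpowers (σ₁ * σ₂))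
  have hdet := congrArg abs (det_mul_det_sq_eq s₁ s₂ (T := G.shiftedLaplacian)
    shiftedLaplacian_translate (fun Δ => quotShiftedLaplacian Δ)
    fun Δ hΔ f => pullback_quotShiftedLaplacian hharm hG hΔ f)
  rw [abs_mul, abs_mul, abs_mul, abs_pow, hG.abs_det_shiftedLaplacian] at hdet
  rw [cΓ] at ha dΓ
  rw [c₁] at ha₁ d₁
  rw [c₂] at ha₂ d₂
  rw [c₃] at ha₃ d₃
  rw [pΓ] at dΓ
  rw [p₁] at d₁
  rw [p₂] at d₂
  rw [p₃] at d₃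
  have hn' : (n : ℚ) ≠ 0 := Nat.cast_ne_zero.2 hn.ne'
  have hV : (Nat.card V : ℚ) ≠ 0 := by
    have := hG.nonempty
    exact Nat.cast_ne_zero.2 Nat.card_pos.ne'
  -- the stabilizer factors cancel because the orbit numbers satisfy the Brauer relation
  have hexp : 2 * a = a₁ + a₂ + a₃ := by
    have ho : (Nat.card V + 2 * Nat.card (G.QuotVert (Subgroup.closure {σ₁, σ₂})) : ℚ) =
      Nat.card (G.QuotVert (Subgroup.zpowers σ₁)) + Nat.card (G.QuotVert (Subgroup.zpowers σ₂)) +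
        Nat.card (G.QuotVert (Subgroup.zpowers (σ₁ * σ₂))) :=
      mod_cast card_add_two_mul_card_quotVert s₁ s₂
    have : (2 * a : ℚ) = a₁ + a₂ + a₃ := by
      rw [ha, ha₁, ha₂, ha₃]
      push_cast
      field_simp
      linear_combination 2 * (n : ℚ) * ho
    exact_mod_cast this
  have hpow : ((2 ^ a : ℕ) : ℚ) ^ 2 = (2 ^ a₁ : ℕ) * (2 ^ a₂ : ℕ) * (2 ^ a₃ : ℕ) := by
    push_cast
    rw [← pow_mul, ← pow_add, ← pow_add, mul_comm a, hexp]
  have hp0 : ((2 ^ a : ℕ) : ℚ) ≠ 0 := by positivity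
  push_cast at dΓ d₁ d₂ d₃ hpow hp0
  -- the determinant relation, with denominators cleared: `(2 * n) ^ 2 = n * (2 * 2 * n)`
  have key : (Nat.card V : ℚ) ^ 2 * Nat.card G.CriticalGroup * (2 ^ a * (Nat.card V : ℚ) ^ 2 *
      Nat.card (G.quot (Subgroup.closure {σ₁, σ₂})).CriticalGroup) ^ 2 =
      n * (2 ^ a₁ * (Nat.card V : ℚ) ^ 2 *
        Nat.card (G.quot (Subgroup.zpowers σ₁)).CriticalGroup) * (2 ^ a₂ * (Nat.card V : ℚ) ^ 2 *
        Nat.card (G.quot (Subgroup.zpowers σ₂)).CriticalGroup) * (2 ^ a₃ * (Nat.card V : ℚ) ^ 2 *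
        Nat.card (G.quot (Subgroup.zpowers (σ₁ * σ₂))).CriticalGroup) := by
    rw [← dΓ, ← d₁, ← d₂, ← d₃]
    linear_combination 4 * (n : ℚ) ^ 2 * hdet
  have hQ : (Nat.card G.CriticalGroup *
        Nat.card (G.quot (Subgroup.closure {σ₁, σ₂})).CriticalGroup ^ 2 : ℚ) =
      n * Nat.card (G.quot (Subgroup.zpowers σ₁)).CriticalGroup *
        Nat.card (G.quot (Subgroup.zpowers σ₂)).CriticalGroup *
        Nat.card (G.quot (Subgroup.zpowers (σ₁ * σ₂))).CriticalGroup := by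
    refine mul_left_cancel₀ (mul_ne_zero (pow_ne_zero 6 hV) (pow_ne_zero 2 hp0)) ?_
    linear_combination key - (Nat.card V : ℚ) ^ 6 *
      (n * Nat.card (G.quot (Subgroup.zpowers σ₁)).CriticalGroup *
        Nat.card (G.quot (Subgroup.zpowers σ₂)).CriticalGroup *
        Nat.card (G.quot (Subgroup.zpowers (σ₁ * σ₂))).CriticalGroup) * hpow
  exact_mod_cast hQ
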